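/- Fix $m$, and for each colour $j\in[m]=\{1,\dots,m\}$ a non-empty proper subset $S_j\subset[m]$. Given a probability vector $\mathbf p=(p_1,\dots,p_m)$ and a family $\boldsymbol\chi=(\chi_1,\dots,\chi_m)$ of probability distributions on $\mathbb N_0^m$, let $\mathcal T_{\boldsymbol\chi}$ be the multi-type Galton–Watson tree whose root $\phi$ has colour $\sigma(\phi)$ distributed according to $\mathbf p$ and in which every vertex $v$ of colour $\sigma(v)=j$ has, independently of all else, $X_{v,k}$ children of colour $k$ for each $k\in[m]$, where $(X_{v,1},\dots,X_{v,m})\sim\chi_j$. Denote its law by $\mathcal L_{\boldsymbol\chi}$ and put $d_0(\mathcal L_{\boldsymbol\chi},\mathcal L_{\boldsymbol\eta})=\max_{j\in[m]}\|\chi_j-\eta_j\|_{TV}$, where $TV$ denotes the total variation distance. Two players take turns to move a token, initially at a given vertex, along edges from parent to child. A move from $u$ to its child $v$ is permissible for P1 (also called Stopper) if $\sigma(v)\in S_{\sigma(u)}$, and for P2 (also called Escaper) if $\sigma(v)\in[m]\setminus S_{\sigma(u)}$; each player must make a move permissible for her if there is one. In the normal game, the first player who is unable to move loses; in the misère game,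 the first player who is unable to move wins; if this never happens, the game is a draw. In the escape game, Stopper wins if some player becomes unable to move, and Escaper wins otherwise. A player wins from a vertex (under optimal play) if she has a winning strategy, and then her opponent loses; the normal or misère game is a draw from a vertex if neither player has a winning strategy. For $i\in\{1,2\}$ and $j\in[m]$ with $p_j>0$, let $nw_{i,j,\boldsymbol\chi}$, $nl_{i,j,\boldsymbol\chi}$, $nd_{i,j,\boldsymbol\chi}$ be the probabilities, conditioned on $\sigma(\phi)=j$, that the normal game started at $\phi$ with P$i$ playing the first round results in a win for P$i$, a loss for P$i$, and a draw, respectively; let $mw_{i,j,\boldsymbol\chi}$, $ml_{i,j,\boldsymbol\chi}$, $md_{i,j,\boldsymbol\chi}$ be the analogous probabilities for the misère game. Let $esw_{j,\boldsymbol\chi}$ (respectively $eel_{j,\boldsymbol\chi}$) be the probability, conditioned on $\sigma(\phi)=j$, that Stopper wins the escape game started at $\phi$ when she plays the first round (respectively, that Escaper loses it when she plays the first round). For $T\subseteq[m]$, let $G_{j,T,\boldsymbol\chi}$ be the probability generating function of $(X_{v,k}:k\in T)$ given $\sigma(v)=j$. Let $\alpha_{j,\boldsymbol\chi}$ (respectively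 $\beta_{j,\boldsymbol\chi}$) be the probability that a vertex of colour $j$ has no child with colour in $S_j$ (respectively in $[m]\setminus S_j$). Define $$\mathcal D_1=\{\mathcal L_{\boldsymbol\chi}:\alpha_{j,\boldsymbol\chi}>0\ \forall j\in[m]\},\qquad \mathcal D_2=\{\mathcal L_{\boldsymbol\chi}:\beta_{j,\boldsymbol\chi}>0\ \forall j\in[m]\},$$ $$\mathcal D_3=\Big\{\mathcal L_{\boldsymbol\chi}:\mathbb E\Big[\sum_{k\in S_j}X_{v,k}\,\Big|\,\sigma(v)=j\Big]<\infty\ \forall j\in[m]\Big\},\qquad \mathcal D_4=\Big\{\mathcal L_{\boldsymbol\chi}:\mathbb E\Big[\sum_{k\in[m]\setminus S_j}X_{v,k}\,\Big|\,\sigma(v)=j\Big]<\infty\ \forall j\in[m]\Big\},$$ $$\mathcal C_1=\{\mathcal L_{\boldsymbol\chi}:G_{j,S_j,\boldsymbol\chi}(\beta_{k,\boldsymbol\chi}:k\in S_j)>\alpha_{j,\boldsymbol\chi}\ \forall j\in[m]\},$$ $$\mathcal C_2=\{\mathcal L_{\boldsymbol\chi}:G_{j,[m]\setminus S_j,\boldsymbol\chi}(\alpha_{k,\boldsymbol\chi}:k\in[m]\setminus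 S_j)>\beta_{j,\boldsymbol\chi}\ \forall j\in[m]\}.$$ Then the following hold for each $i\in\{1,2\}$ and each $j\in[m]$ with $p_j>0$. (i) If $\mathcal L_{\boldsymbol\chi}\in(\mathcal D_1\cup\mathcal D_4)\cap(\mathcal D_2\cup\mathcal D_3)$, then $nw_{i,j}$ and $nl_{i,j}$, as functions of the law with respect to the metric $d_0$, are lower semicontinuous at $\mathcal L_{\boldsymbol\chi}$. If, moreover, $nd_{i,j,\boldsymbol\chi}=0$, then they are continuous at $\mathcal L_{\boldsymbol\chi}$. (ii) If $\mathcal L_{\boldsymbol\chi}\in(\mathcal C_1\cup\mathcal D_4)\cap(\mathcal C_2\cup\mathcal D_3)$, then $mw_{i,j}$ and $ml_{i,j}$ are lower semicontinuous at $\mathcal L_{\boldsymbol\chi}$ with respect to $d_0$. If, moreover, $md_{i,j,\boldsymbol\chi}=0$, then they are continuous at $\mathcal L_{\boldsymbol\chi}$. (iii) If $\mathcal L_{\boldsymbol\chi}\in\mathcal D_3\cap\mathcal D_4$, then $esw_j$ and $eel_j$ are lower semicontinuous at $\mathcal L_{\boldsymbol\chi}$ with respect to $d_0$. -/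

import Mathlib

open MeasureTheory ProbabilityTheory
open scoped ENNReal Topology

namespace GWGames

/-! ### Families of offspring distributions and the distance `d₀` -/

/-- A family `χ = (χ_j)` of offspring distributions, indexed by the `m` colours: `χ_j` is a
probability distribution on `ℕ^m`, the distribution of the numbers of children of each colour of a
vertex of colour `j`. It parametrises the law of the multi-type Galton-Watson tree. -/
@[ext] structure Law (m : ℕ) where
  offspring : Fin m → PMF (Fin m → ℕ)

/-- Total variation distance of two probability distributions on a countable set. -/
noncomputable def tvDist {α : Type*} (μ ν : PMF α) : ℝ :=
  (1 / 2) * ∑' a, |(μ a).toReal - (ν a).toReal|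

/-- `d₀(χ, η) = max_j ‖χ_j - η_j‖_TV`. -/
noncomputable def d₀ {m : ℕ} (χ η : Law m) : ℝ :=
  ⨆ j, tvDist (χ.offspring j) (η.offspring j)

section Metric

variable {α : Type*}

theorem summable_toReal (μ : PMF α) : Summable fun a => (μ a).toReal :=
  ENNReal.summable_toReal μ.tsum_coe_ne_top

theorem summable_abs_sub (μ ν : PMF α) :
    Summable fun a => |(μ a).toReal - (ν a).toReal| :=
  ((summable_toReal μ).sub (summable_toReal ν)).abs

theorem tvDist_self (μ : PMF α) : tvDist μ μ = 0 := by simp [tvDist]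

theorem tvDist_comm (μ ν : PMF α) : tvDist μ ν = tvDist ν μ := by
  simp only [tvDist, abs_sub_comm]

theorem tvDist_triangle (μ ν ρ : PMF α) : tvDist μ ρ ≤ tvDist μ ν + tvDist ν ρ := by
  unfold tvDist
  rw [← mul_add, ← (summable_abs_sub μ ν).tsum_add (summable_abs_sub ν ρ)]
  refine mul_le_mul_of_nonneg_left ?_ (by norm_num)
  exact (summable_abs_sub μ ρ).tsum_le_tsum (fun a => abs_sub_le _ _ _)
    ((summable_abs_sub μ ν).add (summable_abs_sub ν ρ))

theorem eq_of_tvDist_le_zero {μ ν : PMF α} (h : tvDist μ ν ≤ 0) : μ = ν := by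
  have h0 : ∑' a, |(μ a).toReal - (ν a).toReal| ≤ 0 := by
    unfold tvDist at h; linarith
  ext a
  have h1 := (summable_abs_sub μ ν).le_tsum a (fun _ _ => abs_nonneg _)
  have h2 : (μ a).toReal - (ν a).toReal = 0 := abs_nonpos_iff.1 (h1.trans h0)
  exact (ENNReal.toReal_eq_toReal_iff' (μ.apply_ne_top a) (ν.apply_ne_top a)).1 (sub_eq_zero.1 h2)

theorem tvDist_le_d₀ {m : ℕ} (χ η : Law m) (j : Fin m) :
    tvDist (χ.offspring j) (η.offspring j) ≤ d₀ χ η :=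
  le_ciSup (f := fun j => tvDist (χ.offspring j) (η.offspring j)) (Set.finite_range _).bddAbove j

/-- The space of laws carries the metric `d₀`. -/
noncomputable instance {m : ℕ} : MetricSpace (Law m) where
  dist := d₀
  dist_self χ := by simp [d₀, tvDist_self]
  dist_comm χ η := by simp only [d₀, tvDist_comm]
  dist_triangle χ η ρ := by
    rcases isEmpty_or_nonempty (Fin m) with h | h
    · simp [d₀]
    · exact ciSup_le fun j => (tvDist_triangle _ (η.offspring j) _).trans
        (add_le_add (tvDist_le_d₀ χ η j) (tvDist_le_d₀ η ρ j))
  eq_of_dist_eq_zero {χ η} h := by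
    ext1
    funext j
    exact eq_of_tvDist_le_zero ((tvDist_le_d₀ χ η j).trans (le_of_eq h))

end Metric

/-! ### The rooted multi-type Galton-Watson tree -/

/-- Labels of potential vertices: `[]` is the root, and `(k, n) :: u` is the `n`-th child of
colour `k` of the vertex `u`. -/
abbrev Vertex (m : ℕ) := List (Fin m × ℕ)

/-- The sample space: the colour of the root, and for each label `v` and each colour `c` the
vector of the numbers of children of each colour that `v` gets in case its colour is `c`. -/
abbrev Sample (m : ℕ) := Fin m × (Vertex m × Fin m → Fin m → ℕ)

variable {m : ℕ}

/-- The root colour has distribution `p`; independently of it, the offspring vectors are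
independent, a vertex of colour `c` having offspring distribution `χ_c`. -/
noncomputable def treeMeasure (p : PMF (Fin m)) (χ : Law m) : Measure (Sample m) :=
  p.toMeasure.prod (Measure.infinitePi fun vc : Vertex m × Fin m => (χ.offspring vc.2).toMeasure)

/-- The colour `σ(v)`. -/
def colour (ω : Sample m) : Vertex m → Fin m
  | [] => ω.1
  | a :: _ => a.1

/-- `X_{v,k}`: the number of children of colour `k` of `v`. -/
def X (ω : Sample m) (v : Vertex m) (k : Fin m) : ℕ := ω.2 (v, colour ω v) k

/-- The label `v` is a vertex of the tree. -/
def InTree (ω : Sample m) : Vertex m → Prop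
  | [] => True
  | a :: u => InTree ω u ∧ a.2 < X ω u a.1

/-- `(u, v)` is an edge of the tree, directed from parent to child. -/
def IsEdge (ω : Sample m) (u v : Vertex m) : Prop := InTree ω v ∧ ∃ a, v = a :: u

/-! ### The games -/

/-- `P1` is also Stopper and `P2` is also Escaper. -/
inductive Player
  | P1
  | P2

namespace Player

def other : Player → Player
  | P1 => P2
  | P2 => P1

/-- The colours that a player may move to from a vertex of colour `j`: `S_j` for `P1` / Stopper
and its complement for `P2` / Escaper. -/
def targets (S : Fin m → Finset (Fin m)) (j : Fin m) : Player → Finset (Fin m)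
  | P1 => S j
  | P2 => (S j)ᶜ

end Player

/-- The edge `(u, v)` is permissible for the player `q`. -/
def Permissible (S : Fin m → Finset (Fin m)) (ω : Sample m) (q : Player) (u v : Vertex m) : Prop :=
  IsEdge ω u v ∧ colour ω v ∈ q.targets S (colour ω u)

/-- A strategy of player `q` tells her where to move from each vertex, and is `none` only where she
has no permissible move. (In a tree, the position of the token determines the past of the game.) -/
def IsStrategy (S : Fin m → Finset (Fin m)) (ω : Sample m) (q : Player)
    (s : Vertex m → Option (Vertex m)) : Prop :=
  ∀ u, (∀ v, s u = some v → Permissible S ω q u v) ∧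
    (s u = none → ∀ v, ¬ Permissible S ω q u v)

/-- The player who is to move after `n` completed rounds if `q` plays the first round. -/
def mover (q : Player) (n : ℕ) : Player := if Even n then q else q.other

/-- The position of the token after `n` rounds, if it starts at `v`, `q` plays the first round and
each player `r` plays according to `s r`; `none` if the game has ended because of a player who could
not move in one of these rounds. -/
def position (s : Player → Vertex m → Option (Vertex m)) (q : Player) (v : Vertex m) :
    ℕ → Option (Vertex m)
  | 0 => some v
  | n + 1 => (position s q v n).bind (s (mover q n))

/-- In the play, `r` is the first player who fails to make a move. -/
def FailsFirst (s : Player → Vertex m → Option (Vertex m)) (q : Player) (v : Vertex m)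
    (r : Player) : Prop :=
  ∃ n, (position s q v n).isSome ∧ position s q v (n + 1) = none ∧ mover q n = r

/-- The player `r` has a strategy such that the event `W` occurs whatever her opponent does. -/
def CanForce (S : Fin m → Finset (Fin m)) (ω : Sample m) (r : Player)
    (W : (Player → Vertex m → Option (Vertex m)) → Prop) : Prop :=
  ∃ s₀, IsStrategy S ω r s₀ ∧ ∀ s : Player → Vertex m → Option (Vertex m),
    (∀ q, IsStrategy S ω q (s q)) → s r = s₀ → W s

/-- `r` can force a win in the normal game from `v` if `q` plays the first round. -/
def NormalWinner (S : Fin m → Finset (Fin m)) (ω : Sample m) (q : Player) (v : Vertex m)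
    (r : Player) : Prop :=
  CanForce S ω r fun s => FailsFirst s q v r.other

/-- `r` can force a win in the misère game from `v` if `q` plays the first round. -/
def MisereWinner (S : Fin m → Finset (Fin m)) (ω : Sample m) (q : Player) (v : Vertex m)
    (r : Player) : Prop :=
  CanForce S ω r fun s => FailsFirst s q v r

/-- Stopper can force a win in the escape game from `v` if `q` plays the first round. -/
def StopperWins (S : Fin m → Finset (Fin m)) (ω : Sample m) (q : Player) (v : Vertex m) : Prop :=
  CanForce S ω .P1 fun s => ∃ r, FailsFirst s q v r

/-! In the following sets, `i` is the player who plays the first round. -/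

section Sets

variable (S : Fin m → Finset (Fin m)) (i : Player) (j : Fin m) (ω : Sample m)

/-- All vertices of colour `j`. -/
def coloured : Set (Vertex m) := {v | InTree ω v ∧ colour ω v = j}

def NW : Set (Vertex m) := {v ∈ coloured j ω | NormalWinner S ω i v i}

def NL : Set (Vertex m) := {v ∈ coloured j ω | NormalWinner S ω i v i.other}

/-- The normal game is a draw: neither player can force a win. -/
def ND : Set (Vertex m) := {v ∈ coloured j ω | ∀ r, ¬ NormalWinner S ω i v r}

def MW : Set (Vertex m) := {v ∈ coloured j ω | MisereWinner S ω i v i}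

def ML : Set (Vertex m) := {v ∈ coloured j ω | MisereWinner S ω i v i.other}

/-- The misère game is a draw: neither player can force a win. -/
def MD : Set (Vertex m) := {v ∈ coloured j ω | ∀ r, ¬ MisereWinner S ω i v r}

/-- Stopper plays the first round and wins. -/
def ESW : Set (Vertex m) := {v ∈ coloured j ω | StopperWins S ω .P1 v}

/-- Escaper plays the first round and loses. -/
def EEL : Set (Vertex m) := {v ∈ coloured j ω | StopperWins S ω .P2 v}

end Sets

/-- The probability that the root belongs to the (random) vertex set `A`, conditioned on the colour
of the root being `j`. -/
noncomputable def rootProb (p : PMF (Fin m)) (j : Fin m) (A : Sample m → Set (Vertex m))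
    (χ : Law m) : ℝ :=
  ((treeMeasure p χ)[{ω | [] ∈ A ω} | {ω | colour ω [] = j}]).toReal

section Probabilities

variable (S : Fin m → Finset (Fin m)) (p : PMF (Fin m)) (i : Player) (j : Fin m) (χ : Law m)

noncomputable def nw : ℝ := rootProb p j (NW S i j) χ
noncomputable def nl : ℝ := rootProb p j (NL S i j) χ
noncomputable def nd : ℝ := rootProb p j (ND S i j) χ
noncomputable def mw : ℝ := rootProb p j (MW S i j) χ
noncomputable def ml : ℝ := rootProb p j (ML S i j) χ
noncomputable def md : ℝ := rootProb p j (MD S i j) χ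
noncomputable def esw : ℝ := rootProb p j (ESW S j) χ
noncomputable def eel : ℝ := rootProb p j (EEL S j) χ

end Probabilities

/-! ### The classes of laws -/

/-- `χ_{j,T}`: the joint distribution of the numbers of children with colours in `T` of a vertex of
colour `j`. -/
noncomputable def marginal (χ : Law m) (j : Fin m) (T : Finset (Fin m)) : PMF (T → ℕ) :=
  (χ.offspring j).map fun n k => n k

/-- `G_{j,T}`: the probability generating function of `χ_{j,T}`. -/
noncomputable def pgf (χ : Law m) (j : Fin m) (T : Finset (Fin m)) (x : T → ℝ) : ℝ :=
  ∑' n : T → ℕ, (∏ k, x k ^ n k) * (marginal χ j T n).toReal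

/-- The probability that a vertex of colour `j` has no child with colour in `T`. -/
noncomputable def noChild (χ : Law m) (j : Fin m) (T : Finset (Fin m)) : ℝ :=
  ((χ.offspring j).toMeasure {n | ∀ k ∈ T, n k = 0}).toReal

/-- The mean number of children with colours in `T` of a vertex of colour `j`. -/
noncomputable def meanChildren (χ : Law m) (j : Fin m) (T : Finset (Fin m)) : ℝ≥0∞ :=
  ∫⁻ n, ∑ k ∈ T, (n k : ℝ≥0∞) ∂(χ.offspring j).toMeasure

section Classes

variable (S : Fin m → Finset (Fin m))

noncomputable def α (χ : Law m) (j : Fin m) : ℝ := noChild χ j (S j)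

noncomputable def β (χ : Law m) (j : Fin m) : ℝ := noChild χ j (S j)ᶜ

def D₁ : Set (Law m) := {χ | ∀ j, 0 < α S χ j}

def D₂ : Set (Law m) := {χ | ∀ j, 0 < β S χ j}

def D₃ : Set (Law m) := {χ | ∀ j, meanChildren χ j (S j) < ∞}

def D₄ : Set (Law m) := {χ | ∀ j, meanChildren χ j (S j)ᶜ < ∞}

def C₁ : Set (Law m) := {χ | ∀ j, α S χ j < pgf χ j (S j) fun k => β S χ k}

def C₂ : Set (Law m) := {χ | ∀ j, β S χ j < pgf χ j (S j)ᶜ fun k => α S χ k}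

end Classes

end GWGames

open GWGames

namespace GWGames

/-! ### Lower semicontinuity of the probability of finitely certified events

The hypotheses of `theorem5` on the classes of laws turn out not to be needed: as the tree is locally
finite, a win is always certified by finitely many offspring vectors, and the probability of an event
with this property is a supremum of sums of nonnegative continuous functions of the law. -/

section Semicontinuity

variable {m : ℕ}

/-! Conditioned on the root colour, an outcome is an event about the array of offspring vectors. If
a player can force the play to end with a prescribed player (or any player) failing, she can do so
within a bounded number of rounds: each vertex has finitely many children, so bounds for all replies
of the opponent have a maximum (`forced_of_forall`), and from a vertex with no bound the opponent
can stay among such vertices forever (`canForce_iff_forced`). A bounded game is decided by finitely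
many offspring vectors (`exists_finset_forcedIn`), so winning events are open: directed unions of
cylinders.

The probability of a cylinder is a countable sum of finite products of point masses, which are
continuous for `d₀`. Sums and suprema of nonnegative continuous functions are lower semicontinuous
(`FinitelyCertified.lowerSemicontinuous_measure`).

For continuity, wins and losses are disjoint, so their probabilities add up to at most 1, with
equality where draws are null. There each is bounded above by 1 minus the other, which is upper
semicontinuous and touches it at the given law. -/

theorem abs_toReal_sub_le_dist (χ η : Law m) (j : Fin m) (a : Fin m → ℕ) :
    |(χ.offspring j a).toReal - (η.offspring j a).toReal| ≤ 2 * dist χ η := by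
  have h := (summable_abs_sub (χ.offspring j) (η.offspring j)).le_tsum a (fun _ _ => abs_nonneg _)
  have h' := tvDist_le_d₀ χ η j
  unfold tvDist at h'
  change _ ≤ 2 * d₀ χ η
  linarith

theorem continuous_offspring_apply (j : Fin m) (a : Fin m → ℕ) :
    Continuous fun χ : Law m => χ.offspring j a := by
  have h : Continuous fun χ : Law m => (χ.offspring j a).toReal :=
    (LipschitzWith.of_dist_le_mul (K := 2) fun χ η => by
      simpa [Real.dist_eq] using abs_toReal_sub_le_dist χ η j a).continuous
  have h' := ENNReal.continuous_ofReal.comp h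
  refine h'.congr fun χ => ?_
  simp [ENNReal.ofReal_toReal ((χ.offspring j).apply_ne_top a)]

/-- The offspring vectors of all potential vertices. -/
abbrev OffspringArray (m : ℕ) := Vertex m × Fin m → Fin m → ℕ

/-- The law of the offspring vectors. -/
noncomputable def arrayMeasure (χ : Law m) : Measure (OffspringArray m) :=
  Measure.infinitePi fun vc : Vertex m × Fin m => (χ.offspring vc.2).toMeasure

instance (χ : Law m) : IsProbabilityMeasure (arrayMeasure χ) := by
  unfold arrayMeasure; infer_instance

/-- The part of `A` that is certified by the coordinates in `F`. -/
def certified (A : Set (OffspringArray m)) (F : Finset (Vertex m × Fin m)) :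
    Set (OffspringArray m) :=
  {x | ∀ y : OffspringArray m, (∀ c ∈ F, y c = x c) → y ∈ A}

/-- Every point of `A` has finitely many coordinates that force membership in `A`. -/
def FinitelyCertified (A : Set (OffspringArray m)) : Prop :=
  ∀ x ∈ A, ∃ F, x ∈ certified A F

variable {A : Set (OffspringArray m)}

theorem certified_mono {F F' : Finset (Vertex m × Fin m)} (h : F ⊆ F') :
    certified A F ⊆ certified A F' :=
  fun _ hx y hy => hx y fun c hc => hy c (h hc)

theorem FinitelyCertified.eq_iUnion (hA : FinitelyCertified A) : A = ⋃ F, certified A F := by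
  ext x
  simp only [Set.mem_iUnion]
  exact ⟨hA x, fun ⟨F, hF⟩ => hF x fun _ _ => rfl⟩

/-- Being certified by `F` depends only on the coordinates in `F`, so this is a cylinder; its base
lies in a countable space, where every set is measurable. -/
theorem certified_eq_preimage (F : Finset (Vertex m × Fin m)) :
    certified A F = F.restrict ⁻¹' (F.restrict '' certified A F) := by
  refine (Set.subset_preimage_image _ _).antisymm ?_
  rintro x ⟨x', hx', h⟩ y hy
  refine hx' y fun c hc => (hy c hc).trans ?_
  exact (congrFun h ⟨c, hc⟩).symm

theorem measurableSet_certified (F : Finset (Vertex m × Fin m)) :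
    MeasurableSet (certified A F) := by
  rw [certified_eq_preimage]
  exact F.measurable_restrict (Set.to_countable _).measurableSet

theorem FinitelyCertified.measurableSet (hA : FinitelyCertified A) : MeasurableSet A := by
  rw [hA.eq_iUnion]
  exact MeasurableSet.iUnion measurableSet_certified

theorem arrayMeasure_certified (χ : Law m) (F : Finset (Vertex m × Fin m)) :
    arrayMeasure χ (certified A F) =
      ∑' y : (F.restrict '' certified A F : Set (F → Fin m → ℕ)),
        ∏ c : F, χ.offspring c.1.2 (y.1 c) := by
  have hm : MeasurableSet (F.restrict '' certified A F : Set (F → Fin m → ℕ)) :=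
    (Set.to_countable _).measurableSet
  conv_lhs => rw [certified_eq_preimage]
  rw [← Measure.map_apply F.measurable_restrict hm, arrayMeasure,
    Measure.infinitePi_map_restrict, ← Measure.tsum_indicator_apply_singleton _ _ hm,
    ← tsum_subtype]
  refine tsum_congr fun y => ?_
  rw [Measure.pi_singleton]
  refine Finset.prod_congr rfl fun c _ => ?_
  exact PMF.toMeasure_apply_singleton _ _ (measurableSet_singleton _)

theorem FinitelyCertified.lowerSemicontinuous_measure (hA : FinitelyCertified A) :
    LowerSemicontinuous fun χ : Law m => arrayMeasure χ A := by
  have hd : Directed (· ⊆ ·) (certified A) := fun F F' => by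
    classical
    exact ⟨F ∪ F', certified_mono Finset.subset_union_left,
      certified_mono Finset.subset_union_right⟩
  have h : (fun χ : Law m => arrayMeasure χ A) =
      fun χ => ⨆ F, arrayMeasure χ (certified A F) := by
    funext χ
    conv_lhs => rw [hA.eq_iUnion]
    exact hd.measure_iUnion
  rw [h]
  refine lowerSemicontinuous_iSup fun F => ?_
  simp_rw [arrayMeasure_certified]
  refine lowerSemicontinuous_tsum fun y => Continuous.lowerSemicontinuous ?_
  refine continuous_iff_continuousAt.2 fun χ => ?_
  -- Multiplication in `ℝ≥0∞` is discontinuous at `(0, ∞)`, so the factors must be finite.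
  refine ENNReal.tendsto_finsetProd_of_ne_top _ (fun c _ => ?_) fun c _ => ?_
  · exact (continuous_offspring_apply c.1.2 (y.1 c)).continuousAt
  · exact (χ.offspring c.1.2).apply_ne_top _

theorem FinitelyCertified.lowerSemicontinuous_real (hA : FinitelyCertified A) :
    LowerSemicontinuous fun χ : Law m => (arrayMeasure χ A).toReal := by
  intro χ y hy
  rcases lt_or_ge y 0 with h0 | h0
  · exact Filter.Eventually.of_forall fun _ => h0.trans_le ENNReal.toReal_nonneg
  · have h1 := (ENNReal.ofReal_lt_iff_lt_toReal h0 (measure_ne_top _ _)).2 hy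
    filter_upwards [hA.lowerSemicontinuous_measure χ _ h1] with η hη
    exact (ENNReal.ofReal_lt_iff_lt_toReal h0 (measure_ne_top _ _)).1 hη

/-- The upper semicontinuous function `a - g` dominates `f` and equals it at `x`. -/
theorem continuousAt_of_lowerSemicontinuousAt_of_add_le {X : Type*} [TopologicalSpace X]
    {f g : X → ℝ} {x : X} {a : ℝ} (hf : LowerSemicontinuousAt f x)
    (hg : LowerSemicontinuousAt g x) (hle : ∀ y, f y + g y ≤ a) (hx : a ≤ f x + g x) :
    ContinuousAt f x := by
  refine continuousAt_iff_lower_upperSemicontinuousAt.2 ⟨hf, fun y hy => ?_⟩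
  filter_upwards [hg (a - y) (by linarith)] with z hz
  linarith [hle z]

/-- The root colour is independent of the array, so conditioning cancels the factor `p j`. -/
theorem rootProb_eq (p : PMF (Fin m)) (j : Fin m) (hp : p j ≠ 0) (B : Sample m → Set (Vertex m))
    (hB : ∀ ω, [] ∈ B ω → ω.1 = j) (χ : Law m) :
    rootProb p j B χ = (arrayMeasure χ {x | [] ∈ B (j, x)}).toReal := by
  have hC : {ω : Sample m | colour ω [] = j} = {j} ×ˢ Set.univ := by
    ext ω; simp [colour]
  have hCB : {ω : Sample m | colour ω [] = j} ∩ {ω | [] ∈ B ω} =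
      {j} ×ˢ {x | [] ∈ B (j, x)} := by
    ext ⟨c, x⟩
    simp only [colour, Set.mem_inter_iff, Set.mem_ofPred_eq, Set.mem_prod, Set.mem_singleton_iff]
    constructor
    · rintro ⟨rfl, h⟩; exact ⟨rfl, h⟩
    · rintro ⟨rfl, h⟩; exact ⟨rfl, h⟩
  have hpj : p.toMeasure {j} = p j := p.toMeasure_apply_singleton j (measurableSet_singleton j)
  have hm : MeasurableSet {ω : Sample m | colour ω [] = j} := by
    rw [hC]; exact (measurableSet_singleton j).prod MeasurableSet.univ
  unfold rootProb
  rw [cond_apply hm, hCB, hC, treeMeasure, Measure.prod_prod, Measure.prod_prod, hpj,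
    measure_univ, mul_one, ← mul_assoc, ENNReal.inv_mul_cancel hp (p.apply_ne_top j), one_mul]
  rfl

end Semicontinuity

/-! ### Winning within a bounded number of rounds -/

section Forcing

variable {m : ℕ} {S : Fin m → Finset (Fin m)}

@[simp] theorem Player.other_other (q : Player) : q.other.other = q := by cases q <;> rfl

theorem Player.eq_other_of_ne {q r : Player} (h : q ≠ r) : q = r.other := by
  cases q <;> cases r <;> first | rfl | exact absurd rfl h

theorem Player.other_ne (q : Player) : q.other ≠ q := by cases q <;> simp [Player.other]

theorem mover_succ (q : Player) (n : ℕ) : mover q (n + 1) = mover q.other n := by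
  unfold mover
  by_cases h : Even n <;> simp [h, Nat.even_add_one]

/-- Peels off the first round, whereas the definition appends the last; inductions on the game need
this form. -/
theorem position_succ (s : Player → Vertex m → Option (Vertex m)) (q : Player) (v : Vertex m)
    (n : ℕ) : position s q v (n + 1) = (s q v).bind fun u => position s q.other u n := by
  induction n with
  | zero => simp [position, mover]
  | succ n ih =>
    rw [position, ih, Option.bind_assoc, mover_succ]
    rfl

theorem position_eq_none_of_le {s : Player → Vertex m → Option (Vertex m)} {q : Player}
    {v : Vertex m} {n k : ℕ} (hnk : n ≤ k) (h : position s q v n = none) :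
    position s q v k = none := by
  induction k, hnk using Nat.le_induction with
  | base => exact h
  | succ k _ ih => rw [position, ih]; rfl

theorem FailsFirst.unique {s : Player → Vertex m → Option (Vertex m)} {q : Player}
    {v : Vertex m} {r r' : Player} (h : FailsFirst s q v r) (h' : FailsFirst s q v r') :
    r = r' := by
  obtain ⟨n, hn, hn', rfl⟩ := h
  obtain ⟨k, hk, hk', rfl⟩ := h'
  rcases lt_trichotomy n k with h | rfl | h
  · simp [position_eq_none_of_le h hn'] at hk
  · rfl
  · simp [position_eq_none_of_le h hk'] at hn

theorem failsFirst_iff (s : Player → Vertex m → Option (Vertex m)) (q : Player) (v : Vertex m)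
    (r : Player) : FailsFirst s q v r ↔
      (s q v = none ∧ q = r) ∨ ∃ u, s q v = some u ∧ FailsFirst s q.other u r := by
  constructor
  · rintro ⟨n, hn, hn', rfl⟩
    cases n with
    | zero => exact .inl ⟨by simpa [position, mover] using hn', by simp [mover]⟩
    | succ n =>
      rw [position_succ] at hn hn'
      cases hs : s q v with
      | none => simp [hs] at hn
      | some u =>
        rw [hs] at hn hn'
        exact .inr ⟨u, rfl, n, hn, hn', (mover_succ q n).symm⟩
  · rintro (⟨h, rfl⟩ | ⟨u, hu, n, hn, hn', rfl⟩)
    · exact ⟨0, by simp [position], by simp [position, mover, h], by simp [mover]⟩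
    · exact ⟨n + 1, by rw [position_succ, hu]; exact hn, by rw [position_succ, hu]; exact hn',
        mover_succ q n⟩

theorem permissible_iff {ω : Sample m} {q : Player} {u v : Vertex m} :
    Permissible S ω q u v ↔
      InTree ω u ∧ ∃ k ∈ q.targets S (colour ω u), ∃ n < X ω u k, v = (k, n) :: u := by
  constructor
  · rintro ⟨⟨h, ⟨k, n⟩, rfl⟩, hk⟩
    exact ⟨h.1, k, hk, n, h.2, rfl⟩
  · rintro ⟨h, k, hk, n, hn, rfl⟩
    exact ⟨⟨⟨h, hn⟩, _, rfl⟩, hk⟩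

theorem finite_setOf_permissible (S : Fin m → Finset (Fin m)) (ω : Sample m) (q : Player)
    (u : Vertex m) : {v | Permissible S ω q u v}.Finite := by
  refine ((Set.finite_univ (α := Fin m)).biUnion fun k _ =>
    (Set.finite_Iio (X ω u k)).image fun n => (k, n) :: u).subset fun v hv => ?_
  obtain ⟨-, k, -, n, hn, rfl⟩ := permissible_iff.1 hv
  exact Set.mem_biUnion (Set.mem_univ k) ⟨n, hn, rfl⟩

/-- Player `a` can force that, when `q` plays the first round from `v`, some player `r` with `R r`
fails to move in one of the first `n` rounds. -/
def ForcedIn (S : Fin m → Finset (Fin m)) (ω : Sample m) (a : Player) (R : Player → Prop) :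
    ℕ → Player → Vertex m → Prop
  | 0, _, _ => False
  | n + 1, q, v => ((∀ u, ¬ Permissible S ω q v u) ∧ R q) ∨
      (q = a ∧ ∃ u, Permissible S ω q v u ∧ ForcedIn S ω a R n q.other u) ∨
      -- Without the existence clause, a stuck opponent would count as forced vacuously, even when
      -- `R q` fails.
      (q ≠ a ∧ (∃ u, Permissible S ω q v u) ∧
        ∀ u, Permissible S ω q v u → ForcedIn S ω a R n q.other u)

variable {ω : Sample m} {a : Player} {R : Player → Prop}

theorem ForcedIn.succ {n : ℕ} {q : Player} {v : Vertex m} (h : ForcedIn S ω a R n q v) :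
    ForcedIn S ω a R (n + 1) q v := by
  induction n generalizing q v with
  | zero => exact h.elim
  | succ n ih =>
    rcases h with h | ⟨hq, u, hu, h⟩ | ⟨hq, hu, h⟩
    · exact .inl h
    · exact .inr (.inl ⟨hq, u, hu, ih h⟩)
    · exact .inr (.inr ⟨hq, hu, fun u hu => ih (h u hu)⟩)

theorem ForcedIn.mono {n k : ℕ} (hnk : n ≤ k) {q : Player} {v : Vertex m}
    (h : ForcedIn S ω a R n q v) : ForcedIn S ω a R k q v := by
  induction k, hnk using Nat.le_induction with
  | base => exact h
  | succ k _ ih => exact ih.succ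

/-- Player `a` can force in a bounded number of rounds that some player `r` with `R r` fails to
move. -/
def Forced (S : Fin m → Finset (Fin m)) (ω : Sample m) (a : Player) (R : Player → Prop)
    (q : Player) (v : Vertex m) : Prop := ∃ n, ForcedIn S ω a R n q v

theorem forced_of_stuck {q : Player} {v : Vertex m} (h : ∀ u, ¬ Permissible S ω q v u)
    (hR : R q) : Forced S ω a R q v := ⟨1, .inl ⟨h, hR⟩⟩

theorem forced_of_exists {v u : Vertex m} (hu : Permissible S ω a v u)
    (h : Forced S ω a R a.other u) : Forced S ω a R a v := by
  obtain ⟨n, hn⟩ := h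
  exact ⟨n + 1, .inr (.inl ⟨rfl, u, hu, hn⟩)⟩

/-- The compactness step: the opponent has finitely many moves, so their individual bounds have a
common one. -/
theorem forced_of_forall {q : Player} (hq : q ≠ a) {v : Vertex m}
    (hu : ∃ u, Permissible S ω q v u)
    (h : ∀ u, Permissible S ω q v u → Forced S ω a R q.other u) : Forced S ω a R q v := by
  choose! f hf using h
  obtain ⟨N, hN⟩ := ((finite_setOf_permissible S ω q v).image f).bddAbove
  exact ⟨N + 1, .inr (.inr ⟨hq, hu, fun u hu' => (hf u hu').mono (hN ⟨u, hu', rfl⟩)⟩)⟩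

open Classical in
/-- A strategy that moves to a vertex with property `P u` from `u` whenever there is one. -/
noncomputable def preferring (S : Fin m → Finset (Fin m)) (ω : Sample m) (q : Player)
    (P : Vertex m → Vertex m → Prop) (u : Vertex m) : Option (Vertex m) :=
  if h : ∃ v, Permissible S ω q u v ∧ P u v then some h.choose
  else if h : ∃ v, Permissible S ω q u v then some h.choose else none

theorem isStrategy_preferring (q : Player) (P : Vertex m → Vertex m → Prop) :
    IsStrategy S ω q (preferring S ω q P) := by
  intro u
  unfold preferring
  split_ifs with h h'
  · exact ⟨fun v hv => Option.some.inj hv ▸ h.choose_spec.1, fun h => by simp at h⟩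
  · exact ⟨fun v hv => Option.some.inj hv ▸ h'.choose_spec, fun h => by simp at h⟩
  · exact ⟨fun v hv => by simp at hv, fun _ v hv => h' ⟨v, hv⟩⟩

theorem exists_preferring_eq {q : Player} {P : Vertex m → Vertex m → Prop} {u : Vertex m}
    (h : ∃ v, Permissible S ω q u v ∧ P u v) :
    ∃ v, preferring S ω q P u = some v ∧ P u v := by
  unfold preferring
  rw [dif_pos h]
  exact ⟨_, rfl, h.choose_spec.2⟩

theorem IsStrategy.eq_none {q : Player} {s : Vertex m → Option (Vertex m)}
    (hs : IsStrategy S ω q s) {u : Vertex m} (h : ∀ v, ¬ Permissible S ω q u v) : s u = none :=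
  Option.eq_none_iff_forall_not_mem.2 fun v hv => h v ((hs u).1 v hv)

theorem IsStrategy.exists_eq_some {q : Player} {s : Vertex m → Option (Vertex m)}
    (hs : IsStrategy S ω q s) {u v : Vertex m} (h : Permissible S ω q u v) :
    ∃ w, s u = some w ∧ Permissible S ω q u w := by
  cases hu : s u with
  | none => exact absurd h ((hs u).2 hu v)
  | some w => exact ⟨w, rfl, (hs u).1 w hu⟩

/-- The strategy always lowers the least number of rounds in which the goal can be forced. That
number depends on the vertex alone, so one positional strategy serves all plays. -/
theorem canForce_of_forced {q : Player} {v : Vertex m} (h : Forced S ω a R q v) :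
    CanForce S ω a fun s => ∃ r, R r ∧ FailsFirst s q v r := by
  refine ⟨preferring S ω a fun u w => ∀ n, ForcedIn S ω a R (n + 1) a u →
    (∀ k, ForcedIn S ω a R k a u → n + 1 ≤ k) → ForcedIn S ω a R n a.other w,
    isStrategy_preferring _ _, fun s hs hsa => ?_⟩
  obtain ⟨n, hn⟩ := h
  -- Strong induction, because the least bound at `v` may be smaller than the given `n`.
  induction n using Nat.strong_induction_on generalizing q v with
  | _ n ih =>
  classical
  have hex : ∃ n, ForcedIn S ω a R n q v := ⟨n, hn⟩
  have hmin := Nat.find_spec hex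
  have hle : ∀ k, ForcedIn S ω a R k q v → Nat.find hex ≤ k := fun k hk => Nat.find_min' hex hk
  have hkn := hle n hn
  generalize Nat.find hex = k at hmin hle hkn
  cases k with
  | zero => exact hmin.elim
  | succ k =>
  rcases hmin with ⟨hst, hR⟩ | ⟨rfl, u, hu, hk⟩ | ⟨hq, ⟨u, hu⟩, hk⟩
  · exact ⟨q, hR, (failsFirst_iff _ _ _ _).2 (.inl ⟨(hs q).eq_none hst, rfl⟩)⟩
  · obtain ⟨w, hw, hP⟩ := exists_preferring_eq
      (S := S) (ω := ω) (q := q) (P := fun u w => ∀ n, ForcedIn S ω q R (n + 1) q u →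
        (∀ k, ForcedIn S ω q R k q u → n + 1 ≤ k) → ForcedIn S ω q R n q.other w)
      -- Minimality on both sides identifies `n + 1` with the least bound `k + 1`.
      ⟨u, hu, fun n h1 h2 => by
        have e : n = k := by
          have := hle _ h1
          have := h2 (k + 1) (.inr (.inl ⟨rfl, u, hu, hk⟩))
          omega
        exact e ▸ hk⟩
    obtain ⟨r, hr, hf⟩ := ih k (by omega) (hP k (.inr (.inl ⟨rfl, u, hu, hk⟩)) hle)
    exact ⟨r, hr, (failsFirst_iff _ _ _ _).2 (.inr ⟨w, hsa ▸ hw, hf⟩)⟩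
  · obtain ⟨w, hw, hP⟩ := (hs q).exists_eq_some hu
    obtain ⟨r, hr, hf⟩ := ih k (by omega) (hk w hP)
    exact ⟨r, hr, (failsFirst_iff _ _ _ _).2 (.inr ⟨w, hw, hf⟩)⟩

/-- The pair of strategies in which `r` plays `s` and her opponent plays `t`. -/
def profile (r : Player) (s t : Vertex m → Option (Vertex m)) :
    Player → Vertex m → Option (Vertex m) :=
  match r with
  | .P1 => fun | .P1 => s | .P2 => t
  | .P2 => fun | .P1 => t | .P2 => s

theorem profile_self (r : Player) (s t : Vertex m → Option (Vertex m)) :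
    profile r s t r = s := by cases r <;> rfl

theorem profile_other (r : Player) (s t : Vertex m → Option (Vertex m)) :
    profile r s t r.other = t := by cases r <;> rfl

theorem isStrategy_profile {r : Player} {s t : Vertex m → Option (Vertex m)}
    (hs : IsStrategy S ω r s) (ht : IsStrategy S ω r.other t) (q : Player) :
    IsStrategy S ω q (profile r s t q) := by
  by_cases h : q = r
  · subst h; rwa [profile_self]
  · obtain rfl := Player.eq_other_of_ne h; rwa [profile_other]

/-- Against `s₀`, the opponent moves to a vertex that is not `Forced` whenever she can. From a
vertex that is not `Forced` the play then never reaches one that is, so no player in `R` gets stuck.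
-/
theorem forced_of_canForce {q : Player} {v : Vertex m}
    (h : CanForce S ω a fun s => ∃ r, R r ∧ FailsFirst s q v r) : Forced S ω a R q v := by
  obtain ⟨s₀, hs₀, h⟩ := h
  set t := preferring S ω a.other fun _ w => ¬ Forced S ω a R a w with ht
  have hst := isStrategy_profile hs₀ (isStrategy_preferring (S := S) (ω := ω) a.other
    fun _ w => ¬ Forced S ω a R a w)
  rw [← ht] at hst
  obtain ⟨r, hr, n, hn⟩ := h (profile a s₀ t) hst (profile_self _ _ _)
  clear h
  by_contra hv
  induction n generalizing q v with
  | zero =>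
    obtain ⟨-, h, rfl⟩ := hn
    have h' : profile a s₀ t q v = none := by simpa [position, mover] using h
    exact hv (forced_of_stuck ((hst q v).2 h') (by simpa [mover] using hr))
  | succ n ih =>
    obtain ⟨h1, h2, h3⟩ := hn
    rw [position_succ] at h1 h2
    rw [mover_succ] at h3
    cases hs : profile a s₀ t q v with
    | none => simp [hs] at h1
    | some u =>
      rw [hs] at h1 h2
      refine ih ⟨h1, h2, h3⟩ fun hu => hv ?_
      have hp := (hst q v).1 u hs
      by_cases hq : q = a
      · subst hq; exact forced_of_exists hp hu
      · refine forced_of_forall hq ⟨u, hp⟩ fun w hw => ?_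
        -- If some move avoids `Forced`, then `t` takes such a move, so `u` is not `Forced`,
        -- contrary to `hu`.
        by_contra hw'
        obtain rfl := Player.eq_other_of_ne hq
        rw [Player.other_other] at hw' hu
        obtain ⟨w', hw1, hw2⟩ := exists_preferring_eq
          (P := fun _ w => ¬ Forced S ω a R a w) ⟨w, hw, hw'⟩
        rw [profile_other, ht, hw1] at hs
        exact hw2 (Option.some.inj hs ▸ hu)

theorem canForce_iff_forced {q : Player} {v : Vertex m} :
    (CanForce S ω a fun s => ∃ r, R r ∧ FailsFirst s q v r) ↔ Forced S ω a R q v :=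
  ⟨forced_of_canForce, canForce_of_forced⟩

/-- Play the two strategies against each other: only one player can fail first. -/
theorem not_canForce_failsFirst_and {q : Player} {v : Vertex m} {r r' : Player} (hr : r ≠ r')
    (h : CanForce S ω a fun s => FailsFirst s q v r)
    (h' : CanForce S ω a.other fun s => FailsFirst s q v r') : False := by
  obtain ⟨s, hs, h⟩ := h
  obtain ⟨t, ht, h'⟩ := h'
  exact hr ((h _ (isStrategy_profile hs ht) (profile_self _ _ _)).unique
    (h' _ (isStrategy_profile hs ht) (profile_other _ _ _)))

end Forcing

/-! ### Winning is finitely certified -/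

section Certificates

variable {m : ℕ} {S : Fin m → Finset (Fin m)} {j : Fin m}

theorem colour_congr (x y : OffspringArray m) (v : Vertex m) :
    colour (j, x) v = colour (j, y) v := by cases v <;> rfl

theorem X_congr {x y : OffspringArray m} {v : Vertex m}
    (h : y (v, colour (j, x) v) = x (v, colour (j, x) v)) (k : Fin m) :
    X (j, y) v k = X (j, x) v k := by
  unfold X
  rw [colour_congr y x]
  exact congrFun h k

/-- The offspring vectors of the proper ancestors of `v` decide. -/
theorem exists_finset_inTree_iff (j : Fin m) (x : OffspringArray m) (v : Vertex m) :
    ∃ F : Finset (Vertex m × Fin m), ∀ y : OffspringArray m, (∀ c ∈ F, y c = x c) →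
      (InTree (j, y) v ↔ InTree (j, x) v) := by
  classical
  induction v with
  | nil => exact ⟨∅, fun _ _ => Iff.rfl⟩
  | cons a u ih =>
    obtain ⟨F, hF⟩ := ih
    refine ⟨insert (u, colour (j, x) u) F, fun y hy => ?_⟩
    rw [Finset.forall_mem_insert] at hy
    simp only [InTree]
    rw [hF y hy.2, X_congr hy.1]

theorem exists_finset_permissible_iff (S : Fin m → Finset (Fin m)) (j : Fin m)
    (x : OffspringArray m) (q : Player) (v : Vertex m) :
    ∃ F : Finset (Vertex m × Fin m), ∀ y : OffspringArray m, (∀ c ∈ F, y c = x c) →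
      ∀ u, (Permissible S (j, y) q v u ↔ Permissible S (j, x) q v u) := by
  classical
  obtain ⟨F, hF⟩ := exists_finset_inTree_iff j x v
  refine ⟨insert (v, colour (j, x) v) F, fun y hy u => ?_⟩
  rw [Finset.forall_mem_insert] at hy
  rw [permissible_iff, permissible_iff, hF y hy.2, colour_congr y x]
  simp only [X_congr hy.1]

theorem exists_finset_forcedIn {a : Player} {R : Player → Prop} {n : ℕ} {q : Player}
    {v : Vertex m} {x : OffspringArray m} (h : ForcedIn S (j, x) a R n q v) :
    ∃ F : Finset (Vertex m × Fin m), ∀ y : OffspringArray m, (∀ c ∈ F, y c = x c) →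
      ForcedIn S (j, y) a R n q v := by
  classical
  induction n generalizing q v with
  | zero => exact h.elim
  | succ n ih =>
    obtain ⟨F, hF⟩ := exists_finset_permissible_iff S j x q v
    rcases h with ⟨h, hR⟩ | ⟨hq, u, hu, h⟩ | ⟨hq, ⟨u, hu⟩, h⟩
    · exact ⟨F, fun y hy => .inl ⟨fun u hu => h u ((hF y hy u).1 hu), hR⟩⟩
    · obtain ⟨F', hF'⟩ := ih h
      refine ⟨F ∪ F', fun y hy => .inr (.inl ⟨hq, u, ?_, ?_⟩)⟩
      · exact (hF y (fun c hc => hy c (Finset.mem_union_left _ hc)) u).2 hu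
      · exact hF' y fun c hc => hy c (Finset.mem_union_right _ hc)
    -- One certificate for each of the finitely many replies; `F` ensures that `y` allows no other
    -- replies than `x`.
    · choose! G hG using fun u hu => ih (h u hu)
      refine ⟨F ∪ (finite_setOf_permissible S (j, x) q v).toFinset.biUnion G, fun y hy => ?_⟩
      have hy' := hF y fun c hc => hy c (Finset.mem_union_left _ hc)
      refine .inr (.inr ⟨hq, ⟨u, (hy' u).2 hu⟩, fun w hw => ?_⟩)
      rw [hy' w] at hw
      refine hG w hw y fun c hc => hy c (Finset.mem_union_right _ ?_)
      exact Finset.mem_biUnion.2 ⟨w, by simpa using hw, hc⟩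

theorem finitelyCertified_canForce (S : Fin m → Finset (Fin m)) (j : Fin m) (a : Player)
    (R : Player → Prop) (q : Player) (v : Vertex m) :
    FinitelyCertified {x : OffspringArray m |
      CanForce S (j, x) a fun s => ∃ r, R r ∧ FailsFirst s q v r} := by
  intro x hx
  obtain ⟨n, hn⟩ := canForce_iff_forced.1 hx
  obtain ⟨F, hF⟩ := exists_finset_forcedIn hn
  exact ⟨F, fun y hy => canForce_iff_forced.2 ⟨n, hF y hy⟩⟩

theorem finitelyCertified_canForce_failsFirst (S : Fin m → Finset (Fin m)) (j : Fin m)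
    (a q : Player) (v : Vertex m) (r : Player) :
    FinitelyCertified {x : OffspringArray m | CanForce S (j, x) a fun s => FailsFirst s q v r} := by
  simpa using finitelyCertified_canForce S j a (· = r) q v

theorem finitelyCertified_stopperWins (S : Fin m → Finset (Fin m)) (j : Fin m) (q : Player)
    (v : Vertex m) :
    FinitelyCertified {x : OffspringArray m | StopperWins S (j, x) q v} := by
  simpa [StopperWins] using finitelyCertified_canForce S j .P1 (fun _ => True) q v

end Certificates

/-! ### Semicontinuity and continuity of the outcome probabilities -/

section Outcomes

variable {m : ℕ}

theorem rootProb_coloured (p : PMF (Fin m)) (j : Fin m) (hp : p j ≠ 0)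
    (P : Sample m → Vertex m → Prop) (χ : Law m) :
    rootProb p j (fun ω => {v ∈ coloured j ω | P ω v}) χ =
      (arrayMeasure χ {x | P (j, x) []}).toReal := by
  rw [rootProb_eq p j hp _ fun ω hω => hω.1.2]
  congr 2
  ext x
  exact ⟨fun h => h.2, fun h => ⟨⟨trivial, rfl⟩, h⟩⟩

theorem lowerSemicontinuous_rootProb (p : PMF (Fin m)) (j : Fin m) (hp : p j ≠ 0)
    (P : Sample m → Vertex m → Prop)
    (hP : FinitelyCertified {x : OffspringArray m | P (j, x) []}) :
    LowerSemicontinuous (rootProb p j fun ω => {v ∈ coloured j ω | P ω v}) := by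
  rw [funext (rootProb_coloured p j hp P)]
  exact hP.lowerSemicontinuous_real

/-- Two incompatible finitely certified outcomes have continuous probabilities at any law under
which almost surely one of them occurs. -/
theorem continuousAt_rootProb (p : PMF (Fin m)) (j : Fin m) (hp : p j ≠ 0)
    (P Q N : Sample m → Vertex m → Prop)
    (hP : FinitelyCertified {x : OffspringArray m | P (j, x) []})
    (hQ : FinitelyCertified {x : OffspringArray m | Q (j, x) []})
    (hPQ : ∀ ω v, P ω v → Q ω v → False) (hN : ∀ ω v, P ω v ∨ Q ω v ∨ N ω v) (χ : Law m)
    (h0 : rootProb p j (fun ω => {v ∈ coloured j ω | N ω v}) χ = 0) :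
    ContinuousAt (rootProb p j fun ω => {v ∈ coloured j ω | P ω v}) χ ∧
      ContinuousAt (rootProb p j fun ω => {v ∈ coloured j ω | Q ω v}) χ := by
  have lP := lowerSemicontinuous_rootProb p j hp P hP χ
  have lQ := lowerSemicontinuous_rootProb p j hp Q hQ χ
  have hle : ∀ η, rootProb p j (fun ω => {v ∈ coloured j ω | P ω v}) η +
      rootProb p j (fun ω => {v ∈ coloured j ω | Q ω v}) η ≤ 1 := fun η => by
    rw [rootProb_coloured p j hp, rootProb_coloured p j hp]
    have hd : Disjoint {x : OffspringArray m | P (j, x) []} {x | Q (j, x) []} :=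
      Set.disjoint_left.2 fun x h h' => hPQ _ _ h h'
    exact (measureReal_union hd hQ.measurableSet (μ := arrayMeasure η)).symm.trans_le
      measureReal_le_one
  have hge : 1 ≤ rootProb p j (fun ω => {v ∈ coloured j ω | P ω v}) χ +
      rootProb p j (fun ω => {v ∈ coloured j ω | Q ω v}) χ := by
    rw [rootProb_coloured p j hp] at h0 ⊢
    rw [rootProb_coloured p j hp]
    have hu : {x : OffspringArray m | P (j, x) []} ∪ {x | Q (j, x) []} ∪ {x | N (j, x) []} =
        Set.univ := by
      ext x; simpa [or_assoc] using hN (j, x) []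
    -- Subadditivity suffices, so the draw event need not be measurable.
    have h1 := measureReal_union_le (μ := arrayMeasure χ)
      ({x : OffspringArray m | P (j, x) []} ∪ {x | Q (j, x) []}) {x | N (j, x) []}
    have h2 := measureReal_union_le (μ := arrayMeasure χ)
      {x : OffspringArray m | P (j, x) []} {x | Q (j, x) []}
    rw [hu, probReal_univ] at h1
    simp only [Measure.real] at h1 h2
    linarith
  exact ⟨continuousAt_of_lowerSemicontinuousAt_of_add_le lP lQ hle hge,
    continuousAt_of_lowerSemicontinuousAt_of_add_le lQ lP
      (fun η => (add_comm _ _).trans_le (hle η)) (hge.trans_eq (add_comm _ _))⟩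

theorem exists_winner_or_draw {W : Player → Prop} (i : Player) :
    W i ∨ W i.other ∨ ∀ r, ¬ W r := by
  by_contra! h
  obtain ⟨h1, h2, r, hr⟩ := h
  by_cases e : r = i
  · exact h1 (e ▸ hr)
  · exact h2 (Player.eq_other_of_ne e ▸ hr)

end Outcomes

end GWGames

open GWGames

theorem theorem5 (m : ℕ) (S : Fin m → Finset (Fin m))
    (hS : ∀ j, (S j).Nonempty ∧ S j ≠ Finset.univ)
    (p : PMF (Fin m)) (i : Player) (j : Fin m) (hp : p j ≠ 0) (χ : Law m) :
    (χ ∈ (D₁ S ∪ D₄ S) ∩ (D₂ S ∪ D₃ S) →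
      (LowerSemicontinuousAt (nw S p i j) χ ∧ LowerSemicontinuousAt (nl S p i j) χ) ∧
      (nd S p i j χ = 0 → ContinuousAt (nw S p i j) χ ∧ ContinuousAt (nl S p i j) χ)) ∧
    (χ ∈ (C₁ S ∪ D₄ S) ∩ (C₂ S ∪ D₃ S) →
      (LowerSemicontinuousAt (mw S p i j) χ ∧ LowerSemicontinuousAt (ml S p i j) χ) ∧
      (md S p i j χ = 0 → ContinuousAt (mw S p i j) χ ∧ ContinuousAt (ml S p i j) χ)) ∧
    (χ ∈ D₃ S ∩ D₄ S →
      LowerSemicontinuousAt (esw S p j) χ ∧ LowerSemicontinuousAt (eel S p j) χ) := by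
  refine ⟨fun _ => ⟨⟨?_, ?_⟩, fun h0 => ?_⟩, fun _ => ⟨⟨?_, ?_⟩, fun h0 => ?_⟩, fun _ => ⟨?_, ?_⟩⟩
  · exact lowerSemicontinuous_rootProb p j hp (fun ω v => NormalWinner S ω i v i)
      (finitelyCertified_canForce_failsFirst S j i i [] _) χ
  · exact lowerSemicontinuous_rootProb p j hp (fun ω v => NormalWinner S ω i v i.other)
      (finitelyCertified_canForce_failsFirst S j i.other i [] _) χ
  · exact continuousAt_rootProb p j hp (fun ω v => NormalWinner S ω i v i)
      (fun ω v => NormalWinner S ω i v i.other) (fun ω v => ∀ r, ¬ NormalWinner S ω i v r)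
      (finitelyCertified_canForce_failsFirst S j i i [] _)
      (finitelyCertified_canForce_failsFirst S j i.other i [] _)
      (fun _ _ => not_canForce_failsFirst_and i.other.other_ne.symm)
      (fun _ _ => exists_winner_or_draw i) χ h0
  · exact lowerSemicontinuous_rootProb p j hp (fun ω v => MisereWinner S ω i v i)
      (finitelyCertified_canForce_failsFirst S j i i [] _) χ
  · exact lowerSemicontinuous_rootProb p j hp (fun ω v => MisereWinner S ω i v i.other)
      (finitelyCertified_canForce_failsFirst S j i.other i [] _) χ
  · exact continuousAt_rootProb p j hp (fun ω v => MisereWinner S ω i v i)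
      (fun ω v => MisereWinner S ω i v i.other) (fun ω v => ∀ r, ¬ MisereWinner S ω i v r)
      (finitelyCertified_canForce_failsFirst S j i i [] _)
      (finitelyCertified_canForce_failsFirst S j i.other i [] _)
      (fun _ _ => not_canForce_failsFirst_and i.other_ne.symm)
      (fun _ _ => exists_winner_or_draw (W := fun r => MisereWinner S _ i _ r) i) χ h0
  · exact lowerSemicontinuous_rootProb p j hp (fun ω v => StopperWins S ω .P1 v)
      (finitelyCertified_stopperWins S j .P1 []) χ
  · exact lowerSemicontinuous_rootProb p j hp (fun ω v => StopperWins S ω .P2 v)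
      (finitelyCertified_stopperWins S j .P2 []) χ
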